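/- Let $\mathfrak c=2^{\aleph_0}$ and give $2^{\mathfrak c}=\{0,1\}^{\mathfrak c}$ the product topology. A space is pseudocompact if every continuous real-valued function on it is bounded. A space $X$ is star-Lindelöf if for every open cover $\mathscr U$ of $X$ there is a Lindelöf subspace $Y\subseteq X$ such that $\bigcup\{U\in\mathscr U: U\cap Y\neq\emptyset\}=X$. Reznichenko's Example is obtained as follows. Let $\mathscr P$ be a partition of $\mathfrak c$ into $\mathfrak c$ many sets, each of cardinality $\mathfrak c$; let $\langle P_\alpha:\alpha<\mathfrak c\rangle$ be an enumeration of $\mathscr P$ without repetition and $\langle s_\alpha:\alpha<\mathfrak c\rangle$ an enumeration (repetitions permitted) of all functions $s:S\to\{0,1\}$ with $S\subseteq\mathfrak c$ countably infinite. Define $x_\alpha\in 2^{\mathfrak c}$ by $x_\alpha(\beta)=s_\alpha(\beta)$ if $\beta\in\operatorname{dom}(s_\alpha)$, and otherwise $x_\alpha(\beta)=1$ if $\beta\in P_\alpha$ and $x_\alpha(\beta)=0$ if $\beta\notin P_\alpha$. Reznichenko's Example is the subspace $\{x_\alpha:\alpha<\mathfrak c\}$ of $2^{\mathfrak c}$.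 Proposition. Such $\langle P_\alpha\rangle$ and $\langle s_\alpha\rangle$ exist, and for every choice of them the following statements are equivalent: 1. CH, that is, $\mathfrak c=\aleph_1$. 2. Every dense pseudocompact subspace of $2^{\mathfrak c}$ is star-Lindelöf. 3. Reznichenko's Example is star-Lindelöf. -/

import Mathlib

open Cardinal

universe u

/-- The continuum hypothesis. -/
def ContinuumHypothesis : Prop :=
  Cardinal.continuum.{0} = Cardinal.aleph 1

/-- A space is pseudocompact if every continuous real-valued function on it is bounded
(the theorem only uses this for subspaces of a Cantor cube, which are all Tychonoff). -/
def IsPseudocompactSpace (X : Type u) [TopologicalSpace X] : Prop :=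
  ∀ f : X → ℝ, Continuous f → ∃ M : ℝ, ∀ x, |f x| ≤ M

/-- The star of a set `Y` with respect to a family `𝒰`: the union of the members of `𝒰`
that meet `Y`. -/
def starOf {X : Type u} (Y : Set X) (𝒰 : Set (Set X)) : Set X :=
  ⋃₀ {U | U ∈ 𝒰 ∧ (U ∩ Y).Nonempty}

/-- A space is star-Lindelöf if for every open cover `𝒰` there is a Lindelöf subspace `Y`
whose star with respect to `𝒰` is the whole space. -/
def IsStarLindelof (X : Type u) [TopologicalSpace X] : Prop :=
  ∀ 𝒰 : Set (Set X), (∀ U ∈ 𝒰, IsOpen U) → ⋃₀ 𝒰 = Set.univ →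
    ∃ Y : Set X, LindelofSpace Y ∧ starOf Y 𝒰 = Set.univ

/-- The functions into `2 = {0, 1}` whose domain is a countably infinite subset of `ι`. -/
abbrev CountablePartialFun (ι : Type u) : Type u :=
  Σ S : {S : Set ι // #S = ℵ₀}, (S.1 → Bool)

/-- The choices on which Reznichenko's example depends, for an index set `ι` of
cardinality `𝔠`: a partition of `ι` into `𝔠` many sets of cardinality `𝔠`, enumerated
without repetition by `ι`, and an enumeration by `ι` (repetitions are permitted) of all
functions into `2` with countably infinite domain contained in `ι`. -/
structure ReznichenkoData (ι : Type u) where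
  P : ι → Set ι
  isPartition_range : Setoid.IsPartition (Set.range P)
  injective_P : Function.Injective P
  mk_P : ∀ α, #(P α) = 𝔠
  s : ι → CountablePartialFun ι
  surjective_s : Function.Surjective s

namespace ReznichenkoData

variable {ι : Type u}

open Classical in
/-- The point `x_α` of `2^ι`: it agrees with `s α` on the domain of `s α`, and with the
characteristic function of `P α` elsewhere. -/
noncomputable def point (R : ReznichenkoData ι) (α : ι) : ι → Bool := fun β =>
  if h : β ∈ (R.s α).1.1 then (R.s α).2 ⟨β, h⟩ else decide (β ∈ R.P α)

/-- Reznichenko's example, the subset `{x_α : α ∈ ι}` of `2^ι`. -/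
def space (R : ReznichenkoData ι) : Set (ι → Bool) :=
  Set.range R.point

end ReznichenkoData

/-! A dense subspace of the cube is pseudocompact iff it meets every nonempty set determined by
countably many coordinates (`CountablyFull`); Reznichenko's example is built to do so. Under CH such
a set contains a dense Lindelöf set, obtained by a Luzin-type recursion
(`exists_dense_isLindelof_subset`), whose star is everything for any open cover. If CH fails,
Lindelöf subsets of the example are countable, since fewer than `𝔠` domains cannot cover any `P a`.
Some cover by sets `z (i a) = true` then has no Lindelöf set with full star. -/

section CantorCube

variable {ι : Type u}

/-- The set of points of `2^ι` that agree on the finite set `c.1` with the indicator of `c.2`. -/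
def cylinder (c : Finset ι × Finset ι) : Set (ι → Bool) :=
  {z | ∀ i ∈ c.1, (z i = true ↔ i ∈ c.2)}

theorem isOpen_setOf_agree (F : Finset ι) (x : ι → Bool) :
    IsOpen {z : ι → Bool | ∀ i ∈ F, z i = x i} := by
  have h : {z : ι → Bool | ∀ i ∈ F, z i = x i} = ⋂ i ∈ F, (fun z => z i) ⁻¹' {x i} := by
    ext z; simp
  rw [h]
  exact isOpen_biInter_finset fun i _ => (isOpen_discrete _).preimage (continuous_apply i)

theorem isOpen_setOf_apply_eq_true (i : ι) : IsOpen {z : ι → Bool | z i = true} := by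
  simpa using isOpen_setOf_agree {i} fun _ => true

theorem exists_finset_agree_subset {O : Set (ι → Bool)} (hO : IsOpen O) {x : ι → Bool}
    (hx : x ∈ O) : ∃ F : Finset ι, ∀ z : ι → Bool, (∀ i ∈ F, z i = x i) → z ∈ O := by
  obtain ⟨F, u, hu, hsub⟩ := isOpen_pi_iff.1 hO x hx
  refine ⟨F, fun z hz => hsub fun i hi => ?_⟩
  rw [hz i hi]
  exact (hu i hi).2

theorem isOpen_cylinder (c : Finset ι × Finset ι) : IsOpen (cylinder c) := by
  classical
  convert isOpen_setOf_agree c.1 (fun i => decide (i ∈ c.2)) using 1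
  ext z
  refine forall₂_congr fun i _ => ?_
  cases z i <;> simp

theorem cylinder_nonempty (c : Finset ι × Finset ι) : (cylinder c).Nonempty := by
  classical
  exact ⟨fun i => decide (i ∈ c.2), fun i _ => by simp⟩

theorem exists_cylinder_subset {O : Set (ι → Bool)} (hO : IsOpen O) {x : ι → Bool} (hx : x ∈ O) :
    ∃ c, x ∈ cylinder c ∧ cylinder c ⊆ O := by
  classical
  obtain ⟨F, hF⟩ := exists_finset_agree_subset hO hx
  refine ⟨(F, F.filter fun i => x i = true), fun i hi => by simpa using fun _ => hi,
    fun z hz => hF z fun i hi => ?_⟩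
  have := hz i hi
  rw [Bool.eq_iff_iff, this]
  simpa using fun _ => hi

/-! ### Countable fullness and pseudocompactness -/

/-- `X` meets every nonempty set determined by countably many coordinates. -/
def CountablyFull (X : Set (ι → Bool)) : Prop :=
  ∀ S : Set ι, S.Countable → ∀ y : ι → Bool, ∃ x ∈ X, ∀ i ∈ S, x i = y i

theorem CountablyFull.dense {X : Set (ι → Bool)} (hX : CountablyFull X) : Dense X := by
  rw [dense_iff_inter_open]
  rintro O hO ⟨y, hy⟩
  obtain ⟨F, hF⟩ := exists_finset_agree_subset hO hy
  obtain ⟨x, hx, hxy⟩ := hX F F.countable_toSet y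
  exact ⟨x, hF x hxy, hx⟩

/-- If `|f| > n` near `x n`, as decided by `F n`, take a cluster point `y` and some `w` in `X`
agreeing with `y` on every `F n`. Splicing a suitable `x n` with `w` gives a point where `|f|` is
both large and near `|f w|`. -/
theorem CountablyFull.isPseudocompactSpace {X : Set (ι → Bool)} (hX : CountablyFull X) :
    IsPseudocompactSpace X := by
  classical
  intro f hf
  by_contra! hunb
  have loc : ∀ (O : Set ℝ), IsOpen O → ∀ x : X, f x ∈ O →
      ∃ F : Finset ι, ∀ z : X, (∀ i ∈ F, z.1 i = x.1 i) → f z ∈ O := by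
    intro O hO x hx
    obtain ⟨V, hV, hVO⟩ := isOpen_induced_iff.1 (hO.preimage hf)
    have hxV : x.1 ∈ V := by
      have : x ∈ Subtype.val ⁻¹' V := by rw [hVO]; exact hx
      exact this
    obtain ⟨F, hF⟩ := exists_finset_agree_subset hV hxV
    refine ⟨F, fun z hz => ?_⟩
    have : z ∈ f ⁻¹' O := by rw [← hVO]; exact hF z hz
    exact this
  choose x hx using fun n : ℕ => hunb n
  choose F hF using fun n : ℕ => loc {r | (n : ℝ) < |r|}
    (isOpen_lt continuous_const continuous_abs) (x n) (hx n)
  obtain ⟨y, -, hy⟩ := isCompact_univ (X := ι → Bool)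
    (f := Filter.map (fun n => (x n).1) Filter.atTop) (by simp)
  have hy' : MapClusterPt y Filter.atTop (fun n => (x n).1) := hy
  obtain ⟨w, hwX, hw⟩ := hX (⋃ n, (F n : Set ι))
    (Set.countable_iUnion fun n => (F n).countable_toSet) y
  obtain ⟨G, hG⟩ := loc {r | |r| < |f ⟨w, hwX⟩| + 1}
    (isOpen_lt continuous_abs continuous_const) ⟨w, hwX⟩ (by simp)
  have hfreq := hy'.frequently ((isOpen_setOf_agree G y).mem_nhds (fun i _ => rfl))
  obtain ⟨N, hN⟩ := exists_nat_gt (|f ⟨w, hwX⟩| + 1)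
  obtain ⟨n, hnN, hn⟩ := (Filter.frequently_atTop.1 hfreq) N
  obtain ⟨z, hzX, hz⟩ := hX (F n ∪ G : Finset ι) (Finset.countable_toSet _)
    (fun i => if i ∈ F n then (x n).1 i else w i)
  have h1 := hF n ⟨z, hzX⟩ fun i hi => by
    have := hz i (by simp [hi])
    simpa [hi] using this
  have h2 := hG ⟨z, hzX⟩ fun i hi => by
    have h := hz i (by simp [hi])
    by_cases hiF : i ∈ F n
    · simp only [hiF, if_true] at h
      exact (h.trans (hn i hi)).trans (hw i (Set.mem_iUnion.2 ⟨n, hiF⟩)).symm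
    · simpa [hiF] using h
  simp only [Set.mem_ofPred_eq] at h1 h2
  have : (N : ℝ) ≤ n := by exact_mod_cast hnN
  linarith

/-- The projection to `S` has metrizable range; if it misses `y`, the reciprocal distance to `y` is
unbounded by density. -/
theorem IsPseudocompactSpace.countablyFull {X : Set (ι → Bool)} (hX : IsPseudocompactSpace X)
    (hd : Dense X) : CountablyFull X := by
  intro S hS y
  have := hS.to_subtype
  let _ := TopologicalSpace.metrizableSpaceMetric (S → Bool)
  let φ : (ι → Bool) → S → Bool := fun x i => x i
  have hφ : Continuous φ := by fun_prop
  by_contra! hne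
  have hpos : ∀ x : X, 0 < dist (φ x) (φ y) := by
    intro x
    rw [dist_pos]
    intro h
    obtain ⟨i, hi, hxi⟩ := hne x x.2
    exact hxi (congrFun h ⟨i, hi⟩)
  obtain ⟨M, hM⟩ := hX (fun x => (dist (φ x) (φ y))⁻¹)
    (((hφ.comp continuous_subtype_val).dist continuous_const).inv₀ fun x => (hpos x).ne')
  have hO : IsOpen {z | dist (φ z) (φ y) < (|M| + 1)⁻¹} :=
    isOpen_lt (hφ.dist continuous_const) continuous_const
  obtain ⟨x, hx, hxX⟩ := dense_iff_inter_open.1 hd _ hO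
    ⟨y, by simp only [Set.mem_ofPred_eq, dist_self]; positivity⟩
  have h1 := hM ⟨x, hxX⟩
  have h2 := hpos ⟨x, hxX⟩
  have h3 : |M| + 1 < (dist (φ x) (φ y))⁻¹ := by
    rw [lt_inv_comm₀ (by positivity) h2]
    exact hx
  have := le_abs_self M
  have := le_abs_self (dist (φ x) (φ y))⁻¹
  simp only at h1
  linarith

/-! ### Chain condition and Baire category -/

/-- A form of the countable chain condition, by closing off: `T` is countable and closed under
choosing, for each cylinder supported in it, a member of `C` meeting it. -/
theorem exists_seq_dense_iUnion_cylinder {C : Set (Finset ι × Finset ι)}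
    (hC : Dense (⋃ c ∈ C, cylinder c)) :
    ∃ e : ℕ → Finset ι × Finset ι, (∀ n, e n ∈ C) ∧ Dense (⋃ n, cylinder (e n)) := by
  classical
  have hex : ∀ p : Finset ι × Finset ι, ∃ c ∈ C, (cylinder p ∩ cylinder c).Nonempty := by
    intro p
    obtain ⟨z, hzp, hz⟩ := dense_iff_inter_open.1 hC _ (isOpen_cylinder p) (cylinder_nonempty p)
    obtain ⟨c, hc, hzc⟩ := Set.mem_iUnion₂.1 hz
    exact ⟨c, hc, z, hzp, hzc⟩
  choose q hqC hq using hex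
  let A : Set ι → Set (Finset ι × Finset ι) := fun S => {p | ↑p.1 ⊆ S ∧ ↑p.2 ⊆ S}
  have hA : ∀ S : Set ι, S.Countable → (A S).Countable := by
    intro S hS
    have h : {F : Finset ι | (F : Set ι) ⊆ S}.Countable :=
      Set.countable_of_injective_of_countable_image Finset.coe_injective.injOn
        ((Set.countable_ofPred_finite_subset hS).mono
          (by rintro _ ⟨F, hF, rfl⟩; exact ⟨F.finite_toSet, hF⟩))
    exact (h.prod h).mono fun p hp => hp
  let S : ℕ → Set ι := fun n => Nat.rec ∅ (fun _ T => T ∪ ⋃ p ∈ A T, ((q p).1 : Set ι)) n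
  have hS1 : ∀ n, S (n + 1) = S n ∪ ⋃ p ∈ A (S n), ((q p).1 : Set ι) := fun n => rfl
  have hSc : ∀ n, (S n).Countable := by
    intro n
    induction n with
    | zero => exact Set.countable_empty
    | succ n ih =>
      rw [hS1]
      exact ih.union ((hA _ ih).biUnion fun p _ => (q p).1.countable_toSet)
  have hmono : Monotone S := monotone_nat_of_le_succ fun n => by
    rw [hS1]; exact Set.subset_union_left
  have hD : (q '' (⋃ n, A (S n))).Countable :=
    (Set.countable_iUnion fun n => hA _ (hSc n)).image q
  obtain ⟨e, he⟩ := hD.exists_eq_range ⟨q (∅, ∅), (∅, ∅), Set.mem_iUnion.2 ⟨0, by simp [A]⟩, rfl⟩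
  refine ⟨e, fun n => ?_, ?_⟩
  · obtain ⟨p, -, hp⟩ : e n ∈ q '' (⋃ n, A (S n)) := by rw [he]; exact ⟨n, rfl⟩
    rw [← hp]; exact hqC p
  rw [dense_iff_inter_open]
  rintro O hO ⟨y, hy⟩
  obtain ⟨r, hyr, hrO⟩ := exists_cylinder_subset hO hy
  have hdir : ∀ G : Finset ι, ↑G ⊆ ⋃ n, S n → ∃ n, ↑G ⊆ S n := by
    intro G hG
    have h : ∀ᶠ n in Filter.atTop, ∀ i ∈ G, i ∈ S n := by
      rw [Filter.eventually_all_finset]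
      intro i hi
      obtain ⟨n, hn⟩ := Set.mem_iUnion.1 (hG hi)
      filter_upwards [Filter.eventually_ge_atTop n] with m hm using hmono hm hn
    exact h.exists
  let T : Set ι := ⋃ n, S n
  obtain ⟨n, hn⟩ := hdir (r.1.filter (· ∈ T)) (by intro i; simp [T])
  obtain ⟨m, hm⟩ := hdir (r.2.filter (· ∈ T)) (by intro i; simp [T])
  let p : Finset ι × Finset ι := (r.1.filter (· ∈ T), r.2.filter (· ∈ T))
  have hp : p ∈ A (S (max n m)) :=
    ⟨hn.trans (hmono (le_max_left n m)), hm.trans (hmono (le_max_right n m))⟩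
  obtain ⟨z, hzp, hzq⟩ := hq p
  have hqT : ∀ i ∈ (q p).1, i ∈ T := fun i hi => Set.mem_iUnion.2 ⟨max n m + 1, by
    rw [hS1]; exact Or.inr (Set.mem_iUnion₂.2 ⟨p, hp, hi⟩)⟩
  obtain ⟨k, hk⟩ : q p ∈ Set.range e := by
    rw [← he]; exact ⟨p, Set.mem_iUnion.2 ⟨_, hp⟩, rfl⟩
  -- `q p` only restricts coordinates in `T`, so `z` may be changed off `T` to satisfy `r`.
  refine ⟨fun i => if i ∈ T then z i else decide (i ∈ r.2), hrO fun i hi => ?_,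
    Set.mem_iUnion.2 ⟨k, ?_⟩⟩
  · by_cases hiT : i ∈ T
    · have := hzp i (by simp [p, hi, hiT])
      simpa [hiT, p] using this
    · simp [hiT]
  · rw [hk]
    intro i hi
    simpa [hqT i hi] using hzq i hi

theorem CountablyFull.exists_mem_cylinder_forall {X : Set (ι → Bool)} (hX : CountablyFull X)
    {κ : Type*} [Countable κ] (e : κ → ℕ → Finset ι × Finset ι)
    (he : ∀ k, Dense (⋃ n, cylinder (e k n))) (c : Finset ι × Finset ι) :
    ∃ x ∈ X, x ∈ cylinder c ∧ ∀ k, x ∈ ⋃ n, cylinder (e k n) := by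
  have hd : Dense (⋂ k, ⋃ n, cylinder (e k n)) :=
    dense_iInter_of_isOpen (fun k => isOpen_iUnion fun n => isOpen_cylinder _) he
  obtain ⟨y, hyc, hy⟩ := dense_iff_inter_open.1 hd _ (isOpen_cylinder c) (cylinder_nonempty c)
  simp only [Set.mem_iInter, Set.mem_iUnion] at hy
  choose n hn using hy
  obtain ⟨x, hx, hxy⟩ := hX (c.1 ∪ ⋃ k, ((e k (n k)).1 : Set ι))
    (c.1.countable_toSet.union (Set.countable_iUnion fun k => Finset.countable_toSet _)) y
  refine ⟨x, hx, fun i hi => ?_, fun k => Set.mem_iUnion.2 ⟨n k, fun i hi => ?_⟩⟩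
  · rw [hxy i (Or.inl hi)]; exact hyc i hi
  · rw [hxy i (Or.inr (Set.mem_iUnion.2 ⟨k, hi⟩))]; exact hn k i hi

end CantorCube

/-! ### Lindelöf sets under CH -/

theorem countable_iff_mk_lt_aleph_one {α : Type u} (s : Set α) : s.Countable ↔ #s < ℵ₁ := by
  rw [← le_aleph0_iff_set_countable, ← succ_aleph0, Order.lt_succ_iff]

theorem mk_nat_fun_eq_continuum {α : Type u} (h : #α = 𝔠) : #(ℕ → α) = 𝔠 := by
  simp [h]

theorem exists_dense_isLindelof_subset {ι : Type u} (hι : #ι = 𝔠) (hι' : #ι = ℵ₁)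
    {X : Set (ι → Bool)} (hX : CountablyFull X) : ∃ L ⊆ X, Dense L ∧ IsLindelof L := by
  have hinf : Infinite ι := by rw [infinite_iff, hι]; exact aleph0_le_continuum
  have hfin : #(Finset ι × Finset ι) = 𝔠 := by
    simp [mk_finset_of_infinite, hι]
  have hseq : #(ℕ → Finset ι × Finset ι) = 𝔠 := mk_nat_fun_eq_continuum hfin
  obtain ⟨g⟩ := Cardinal.eq.1 (hι.trans hfin.symm)
  obtain ⟨E⟩ := Cardinal.eq.1 (hι.trans hseq.symm)
  obtain ⟨_, _, ho⟩ := exists_ord_eq_type_lt ι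
  have hIio : ∀ a : ι, (Set.Iio a).Countable := fun a => by
    rw [countable_iff_mk_lt_aleph_one, ← hι']
    exact mk_Iio_lt a ho
  have hex : ∀ a, ∃ x ∈ X, x ∈ cylinder (g a) ∧
      ∀ b ≤ a, Dense (⋃ n, cylinder (E b n)) → x ∈ ⋃ n, cylinder (E b n) := by
    intro a
    have : Countable {b | b ≤ a ∧ Dense (⋃ n, cylinder (E b n))} := by
      refine Set.Countable.to_subtype (((hIio a).union (Set.countable_singleton a)).mono ?_)
      rintro b ⟨hb, -⟩
      exact hb.lt_or_eq
    obtain ⟨x, hx, hxc, h⟩ := hX.exists_mem_cylinder_forall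
      (fun b : {b | b ≤ a ∧ Dense (⋃ n, cylinder (E b n))} => E b) (fun b => b.2.2) (g a)
    exact ⟨x, hx, hxc, fun b hb hd => h ⟨b, hb, hd⟩⟩
  choose y hyX hyg hyE using hex
  have hd : Dense (Set.range y) := by
    rw [dense_iff_inter_open]
    rintro O hO ⟨z, hz⟩
    obtain ⟨c, -, hcO⟩ := exists_cylinder_subset hO hz
    refine ⟨y (g.symm c), hcO ?_, Set.mem_range_self _⟩
    simpa using hyg (g.symm c)
  refine ⟨Set.range y, Set.range_subset_iff.2 hyX, hd, isLindelof_of_countable_subcover ?_⟩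
  intro κ U hU hcov
  have hcov' : ∀ a, ∃ k, y a ∈ U k := fun a => Set.mem_iUnion.1 (hcov ⟨a, rfl⟩)
  choose k hk using hcov'
  have hC : Dense (⋃ c ∈ {c : Finset ι × Finset ι | ∃ k, cylinder c ⊆ U k}, cylinder c) := by
    refine hd.mono ?_
    rintro _ ⟨a, rfl⟩
    obtain ⟨c, hyc, hc⟩ := exists_cylinder_subset (hU (k a)) (hk a)
    exact Set.mem_iUnion₂.2 ⟨c, ⟨k a, hc⟩, hyc⟩
  obtain ⟨e, heC, he⟩ := exists_seq_dense_iUnion_cylinder hC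
  choose l hl using heC
  obtain ⟨b, rfl⟩ := E.surjective e
  -- Points with index at least `b` lie in the dense union coded by `b`; only countably many come
  -- earlier.
  refine ⟨Set.range l ∪ k '' Set.Iio b, (Set.countable_range l).union ((hIio b).image k), ?_⟩
  rintro _ ⟨a, rfl⟩
  rcases lt_or_ge a b with hab | hab
  · exact Set.mem_iUnion₂.2 ⟨k a, Or.inr ⟨a, hab, rfl⟩, hk a⟩
  · obtain ⟨n, hn⟩ := Set.mem_iUnion.1 (hyE a b hab he)
    exact Set.mem_iUnion₂.2 ⟨l n, Or.inl ⟨n, rfl⟩, hl n hn⟩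

theorem isStarLindelof_of_dense_isLindelof {Z : Type u} [TopologicalSpace Z] {X L : Set Z}
    (hLX : L ⊆ X) (hd : Dense L) (hL : IsLindelof L) : IsStarLindelof X := by
  intro 𝒰 hU hcov
  refine ⟨Subtype.val ⁻¹' L, ?_, ?_⟩
  · rw [← isLindelof_iff_lindelofSpace, Subtype.isLindelof_iff, Subtype.image_preimage_coe,
      Set.inter_eq_right.2 hLX]
    exact hL
  · refine Set.eq_univ_of_forall fun x => ?_
    obtain ⟨U, hUU, hx⟩ : x ∈ ⋃₀ 𝒰 := by rw [hcov]; trivial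
    refine ⟨U, ⟨hUU, ?_⟩, hx⟩
    obtain ⟨V, hV, rfl⟩ := isOpen_induced_iff.1 (hU U hUU)
    obtain ⟨z, hzV, hzL⟩ := dense_iff_inter_open.1 hd V hV ⟨x, hx⟩
    exact ⟨⟨z, hLX hzL⟩, hzV, hzL⟩

/-! ### Cardinalities and existence of the data -/

theorem ContinuumHypothesis.continuum_eq (h : ContinuumHypothesis) : 𝔠 = ℵ_ (1 : Ordinal.{u}) := by
  have := congrArg Cardinal.lift.{u} h
  simpa using this

theorem ContinuumHypothesis.of_continuum_le (h : 𝔠 ≤ ℵ_ (1 : Ordinal.{u})) :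
    ContinuumHypothesis := by
  have h' : 𝔠 = ℵ_ (1 : Ordinal.{u}) := h.antisymm aleph_one_le_continuum
  unfold ContinuumHypothesis
  rw [← Cardinal.lift_inj.{0, u}]
  simpa using h'

theorem mk_countablePartialFun_le {ι : Type u} (hι : #ι = 𝔠) : #(CountablePartialFun ι) ≤ 𝔠 := by
  have hcard : #(ℕ → ι × Bool) = 𝔠 := mk_nat_fun_eq_continuum (by
    rw [mk_prod, hι, lift_continuum, mk_bool, lift_two]
    exact mul_eq_left aleph0_le_continuum (nat_lt_continuum 2).le two_ne_zero)
  rw [← hcard]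
  have he : ∀ t : CountablePartialFun ι, Nonempty (ℕ ≃ t.1.1) := fun t => by
    have := t.1.2
    rw [← Cardinal.lift_mk_eq'.{0, u}, this]; simp
  let e := fun t => (he t).some
  -- A partial function is recovered from an enumeration of its graph.
  refine mk_le_of_injective (f := fun t n => ((e t n : ι), t.2 (e t n))) ?_
  intro t t' h
  have hmem : ∀ {t t' : CountablePartialFun ι},
      (fun n => ((e t n : ι), t.2 (e t n))) = (fun n => ((e t' n : ι), t'.2 (e t' n))) →
      ∀ i (hi : i ∈ t.1.1), ∃ hi' : i ∈ t'.1.1, t.2 ⟨i, hi⟩ = t'.2 ⟨i, hi'⟩ := by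
    intro t t' h i hi
    obtain ⟨n, hn⟩ := (e t).surjective ⟨i, hi⟩
    have h1 := congrFun h n
    simp only [hn, Prod.mk.injEq] at h1
    obtain ⟨h1, h2⟩ := h1
    subst h1
    exact ⟨(e t' n).2, h2⟩
  have hS : t.1 = t'.1 := Subtype.ext (Set.ext fun i =>
    ⟨fun hi => (hmem h i hi).1, fun hi => (hmem h.symm i hi).1⟩)
  obtain ⟨S, f⟩ := t
  obtain ⟨S', f'⟩ := t'
  obtain rfl : S = S' := hS
  congr 1
  funext i
  exact (hmem h i i.2).2

theorem nonempty_reznichenkoData {ι : Type u} (hι : #ι = 𝔠) : Nonempty (ReznichenkoData ι) := by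
  have hinf : Infinite ι := by rw [infinite_iff, hι]; exact aleph0_le_continuum
  obtain ⟨f⟩ : Nonempty (ι ≃ ι × ι) := Cardinal.eq.1 (by simp [hι])
  obtain ⟨S, hS⟩ : ∃ S : Set ι, #S = ℵ₀ :=
    le_mk_iff_exists_set.1 (by rw [hι]; exact aleph0_le_continuum)
  have : Nonempty (CountablePartialFun ι) := ⟨⟨⟨S, hS⟩, fun _ => false⟩⟩
  obtain ⟨⟨j, hj⟩⟩ : #(CountablePartialFun ι) ≤ #ι := hι ▸ mk_countablePartialFun_le hι
  refine ⟨⟨fun a => {b | (f b).1 = a}, ⟨?_, ?_⟩, ?_, ?_, Function.invFun j,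
    Function.invFun_surjective hj⟩⟩
  · rintro ⟨a, ha⟩
    exact Set.eq_empty_iff_forall_notMem.1 ha (f.symm (a, a)) (by simp)
  · intro b
    refine ⟨{b' | (f b').1 = (f b).1}, ⟨⟨_, rfl⟩, rfl⟩, ?_⟩
    rintro _ ⟨⟨a, rfl⟩, hb⟩
    simp only [Set.mem_ofPred_eq] at hb
    rw [hb]
  · intro a a' h
    have h' := Set.ext_iff.1 h (f.symm (a, a))
    simpa using h'
  · intro a
    rw [← hι]
    refine Cardinal.mk_congr ⟨fun b => (f b).2, fun c => ⟨f.symm (a, c), by simp⟩, ?_, ?_⟩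
    · rintro ⟨b, rfl⟩
      simp
    · intro c
      simp

/-! ### Reznichenko's example -/

namespace ReznichenkoData

variable {ι : Type u} (R : ReznichenkoData ι)

theorem countable_dom (a : ι) : (R.s a).1.1.Countable := by
  rw [← le_aleph0_iff_set_countable, (R.s a).1.2]

theorem eq_of_mem_of_mem {a b i : ι} (ha : i ∈ R.P a) (hb : i ∈ R.P b) : a = b :=
  R.injective_P ((R.isPartition_range.2 i).unique ⟨⟨a, rfl⟩, ha⟩ ⟨⟨b, rfl⟩, hb⟩)

theorem point_of_notMem {a i : ι} (h : i ∉ (R.s a).1.1) : R.point a i = true ↔ i ∈ R.P a := by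
  simp [point, h]

theorem countablyFull_space (hι : #ι = 𝔠) : CountablyFull R.space := by
  intro S hS y
  -- `T` pads `S`, which may be finite, to an infinite domain.
  obtain ⟨T, hT⟩ : ∃ T : Set ι, #T = ℵ₀ :=
    le_mk_iff_exists_set.1 (by rw [hι]; exact aleph0_le_continuum)
  have hST : #(S ∪ T : Set ι) = ℵ₀ := by
    refine le_antisymm ?_ (hT ▸ mk_le_mk_of_subset Set.subset_union_right)
    rw [le_aleph0_iff_set_countable]
    exact hS.union (le_aleph0_iff_set_countable.1 hT.le)
  obtain ⟨a, ha⟩ := R.surjective_s ⟨⟨S ∪ T, hST⟩, fun i => y i⟩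
  refine ⟨R.point a, ⟨a, rfl⟩, fun i hi => ?_⟩
  unfold point
  rw [ha]
  simp [hi]

theorem exists_mem_notMem_dom {B : Set ι} (hB : #B < 𝔠) (a : ι) :
    ∃ i ∈ R.P a, ∀ b ∈ B, i ∉ (R.s b).1.1 := by
  have hlt : #(⋃ b ∈ B, (R.s b).1.1) < #(R.P a) := by
    rw [R.mk_P]
    refine (mk_biUnion_le _ B).trans_lt (mul_lt_of_lt aleph0_le_continuum hB ?_)
    refine lt_of_le_of_lt (ciSup_le' fun b => ?_) aleph0_lt_continuum
    exact (R.s b).1.2.le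
  obtain ⟨i, hi, hi'⟩ := Set.not_subset.1 fun h => hlt.not_ge (mk_le_mk_of_subset h)
  exact ⟨i, hi, fun b hb h => hi' (Set.mem_iUnion₂.2 ⟨b, hb, h⟩)⟩

/-- Given `ℵ₁` indices `B`, choose `i a` in `P a` off the domains for `B` and `a`. The sets `z (i a)
= true` cover the example, but a point indexed by `b` in `B` lies only in the one for `b`. -/
theorem countable_preimage_of_isLindelof (hc : ℵ₁ < (𝔠 : Cardinal.{u})) {L : Set (ι → Bool)}
    (hL : IsLindelof L) (hLX : L ⊆ R.space) : (R.point ⁻¹' L).Countable := by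
  by_contra hunc
  rw [countable_iff_mk_lt_aleph_one, not_lt, le_mk_iff_exists_subset] at hunc
  obtain ⟨B, hBL, hB⟩ := hunc
  have hins : ∀ a, #(insert a B : Set ι) < 𝔠 := fun a =>
    (mk_insert_le.trans_eq (by rw [hB])).trans_lt
      (add_lt_of_lt aleph0_le_continuum hc (one_lt_aleph0.trans aleph0_lt_continuum))
  choose i hiP hi using fun a => R.exists_mem_notMem_dom (hins a) a
  obtain ⟨C, hC, hcov⟩ := hL.elim_countable_subcover (fun a => {z : ι → Bool | z (i a) = true})
    (fun a => isOpen_setOf_apply_eq_true (i a)) (by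
      intro z hz
      obtain ⟨a, rfl⟩ := hLX hz
      exact Set.mem_iUnion.2 ⟨a, (R.point_of_notMem (hi a a (Set.mem_insert _ _))).2 (hiP a)⟩)
  have hBC : B ⊆ C := by
    intro b hb
    obtain ⟨a, ha, hba⟩ := Set.mem_iUnion₂.1 (hcov (hBL hb))
    have h := (R.point_of_notMem (hi a b (Set.mem_insert_of_mem _ hb))).1 hba
    rwa [← R.eq_of_mem_of_mem (hiP a) h]
  have := (countable_iff_mk_lt_aleph_one B).1 (hC.mono hBC)
  exact this.ne hB

theorem not_isStarLindelof_space (hι : #ι = 𝔠) (hc : ℵ₁ < (𝔠 : Cardinal.{u})) :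
    ¬ IsStarLindelof R.space := by
  intro hstar
  choose i hiP hi using fun a => R.exists_mem_notMem_dom (B := {a})
    (by rw [mk_singleton]; exact one_lt_aleph0.trans aleph0_lt_continuum) a
  have hinj : Function.Injective i := fun a b h =>
    R.eq_of_mem_of_mem (hiP a) (by rw [h]; exact hiP b)
  let U : ι → Set R.space := fun a => {z | z.1 (i a) = true}
  obtain ⟨Y, hY, hYU⟩ := hstar (Set.range U)
    (by
      rintro _ ⟨a, rfl⟩
      exact (isOpen_setOf_apply_eq_true (i a)).preimage continuous_subtype_val)
    (by
      refine Set.eq_univ_of_forall ?_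
      rintro ⟨_, a, rfl⟩
      exact ⟨U a, ⟨a, rfl⟩, (R.point_of_notMem (hi a a rfl)).2 (hiP a)⟩)
  have hYL : IsLindelof (Subtype.val '' Y) :=
    Subtype.isLindelof_iff.1 (isLindelof_iff_lindelofSpace.2 hY)
  have hA := R.countable_preimage_of_isLindelof hc hYL (by rintro _ ⟨y, -, rfl⟩; exact y.2)
  set A := R.point ⁻¹' (Subtype.val '' Y) with hAdef
  have hC : {a | (U a ∩ Y).Nonempty}.Countable := by
    refine (hA.union ((hA.biUnion fun b _ => R.countable_dom b).preimage hinj)).mono ?_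
    rintro a ⟨⟨_, b, rfl⟩, hzU, hzY⟩
    have hbA : b ∈ A := ⟨_, hzY, rfl⟩
    by_cases h : i a ∈ (R.s b).1.1
    · exact Or.inr (Set.mem_iUnion₂.2 ⟨b, hbA, h⟩)
    · rw [R.eq_of_mem_of_mem (hiP a) ((R.point_of_notMem h).1 hzU)]
      exact Or.inl hbA
  -- Only countably many cover members meet `Y`; some `x` in the example avoids them all.
  obtain ⟨x, hx, hx0⟩ := R.countablyFull_space hι _ (hC.image i) (fun _ => false)
  obtain ⟨_, ⟨⟨a, rfl⟩, ha⟩, hxa⟩ : (⟨x, hx⟩ : R.space) ∈ starOf Y (Set.range U) := by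
    rw [hYU]; trivial
  have h0 := hx0 (i a) ⟨a, ha, rfl⟩
  have h1 : x (i a) = true := hxa
  simp [h0] at h1

end ReznichenkoData

theorem mainTheorem2 {ι : Type u} (hι : #ι = 𝔠) :
    Nonempty (ReznichenkoData ι) ∧
    ∀ R : ReznichenkoData ι,
      List.TFAE [
        ContinuumHypothesis,
        ∀ X : Set (ι → Bool), Dense X → IsPseudocompactSpace X → IsStarLindelof X,
        IsStarLindelof R.space] := by
  refine ⟨nonempty_reznichenkoData hι, fun R => ?_⟩
  tfae_have 1 → 2 := by
    intro hCH X hd hX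
    obtain ⟨L, hLX, hLd, hL⟩ := exists_dense_isLindelof_subset hι (hι.trans hCH.continuum_eq)
      (hX.countablyFull hd)
    exact isStarLindelof_of_dense_isLindelof hLX hLd hL
  tfae_have 2 → 3 := fun h =>
    h _ (R.countablyFull_space hι).dense (R.countablyFull_space hι).isPseudocompactSpace
  tfae_have 3 → 1 := by
    intro h
    by_contra hCH
    exact R.not_isStarLindelof_space hι
      (not_le.1 fun hle => hCH (ContinuumHypothesis.of_continuum_le hle)) h
  tfae_finish
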